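/- Let $\mathbb{S}^2=\{x\in\mathbb{R}^3:\|x\|=1\}$, and for $w\in\mathbb{S}^2$ and $t\in[-1,1]$ let $C(w,t)=\{x\in\mathbb{S}^2:\langle x,w\rangle\ge t\}$ be the spherical cap with center $w$ and height $t$; $\partial C(w,t)$ denotes its boundary in $\mathbb{S}^2$. Write the points of $\mathbb{S}^2$ other than the poles as $\gamma(\phi,\theta)=(\cos\phi\sin\theta,\ \sin\phi\sin\theta,\ \cos\theta)$ with $\phi\in[0,2\pi)$, $\theta\in(0,\pi)$, and let $m(\phi)\in[0,\frac{\pi}{2})$ be the residue of $\phi$ modulo $\frac{\pi}{2}$. The HEALPix projection $\Gamma$ from the sphere to the plane $\mathbb{R}^2$ is given by $$\Gamma(\gamma(\phi,\theta))=\begin{cases}\left(\frac{\phi}{\pi},\ \frac38\cos\theta\right), & |\cos\theta|\le\frac23,\\[4pt] \frac1\pi\left(\phi-\big(1-\sqrt{3(1-|\cos\theta|)}\big)\big(m(\phi)-\tfrac{\pi}{4}\big),\ \tfrac{\pi}{4}\big(2-\sqrt{3(1-|\cos\theta|)}\big)\right), & \cos\theta>\frac23,\\[4pt] \frac1\pi\left(\phi-\big(1-\sqrt{3(1-|\cos\theta|)}\big)\big(m(\phi)-\tfrac{\pi}{4}\big),\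 \tfrac{\pi}{4}\big(\sqrt{3(1-|\cos\theta|)}-2\big)\right), & \cos\theta<-\frac23,\end{cases}$$ and at the two poles $(0,0,\pm1)$ by the same formulas with $\phi=0$ (a choice that does not affect lengths). Then for every $w\in\mathbb{S}^2$ and every $t\in(-1,1)$ the image $\beta=\Gamma(\partial C(w,t))$ satisfies $$\operatorname{length}(\beta)\le 5+\sqrt2<6.42,$$ where the length of the set $\beta\subset\mathbb{R}^2$ is its one-dimensional Hausdorff measure with respect to the Euclidean distance. -/

import Mathlib

open MeasureTheory

noncomputable section

/-- The unit sphere in Euclidean three-space. -/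
abbrev Sphere2 : Type := Metric.sphere (0 : EuclideanSpace ℝ (Fin 3)) 1

/-- The spherical cap with center `w` and height `t`. -/
def sphericalCap (w : Sphere2) (t : ℝ) : Set Sphere2 :=
  {x | t ≤ inner ℝ (x : EuclideanSpace ℝ (Fin 3)) (w : EuclideanSpace ℝ (Fin 3))}

/-- Spherical coordinates: `φ` is the longitude and `θ` the colatitude. -/
def sphericalPoint (φ θ : ℝ) : Sphere2 :=
  ⟨!₂[Real.cos φ * Real.sin θ, Real.sin φ * Real.sin θ, Real.cos θ], by
    rw [mem_sphere_zero_iff_norm, EuclideanSpace.norm_eq, Real.sqrt_eq_one]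
    simp [Fin.sum_univ_three]
    linear_combination (Real.sin θ) ^ 2 * Real.sin_sq_add_cos_sq φ + Real.sin_sq_add_cos_sq θ⟩

/-- The HEALPix projection in terms of the longitude `φ ∈ [0, 2π)` and of `z = cos θ`.
Here `toIcoMod _ 0 φ` is `φ` modulo `π / 2`, with values in `[0, π / 2)`. -/
def healpixCoord (φ z : ℝ) : EuclideanSpace ℝ (Fin 2) :=
  if |z| ≤ 2 / 3 then
    !₂[φ / Real.pi, 3 / 8 * z]
  else if 2 / 3 < z then
    (1 / Real.pi) •
      !₂[φ - (1 - √(1 - z) * √3) * (toIcoMod Real.pi_div_two_pos 0 φ - Real.pi / 4),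
        Real.pi / 4 * (2 - √(1 - z) * √3)]
  else
    (1 / Real.pi) •
      !₂[φ - (1 - √(1 - |z|) * √3) * (toIcoMod Real.pi_div_two_pos 0 φ - Real.pi / 4),
        Real.pi / 4 * (√(1 - |z|) * √3 - 2)]

/-- The longitude, in `[0, 2π)`, of a point of the sphere (it is `0` at the two poles). -/
def longitude (x : Sphere2) : ℝ :=
  toIcoMod Real.two_pi_pos 0 (Complex.arg ⟨x.1 0, x.1 1⟩)

/-- The HEALPix projection of the sphere into the plane. Away from the poles it is given in
spherical coordinates by `healpix_sphericalPoint` below; the value at each pole is one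
of the limits of nearby values. -/
def healpix (x : Sphere2) : EuclideanSpace ℝ (Fin 2) :=
  healpixCoord (longitude x) (x.1 2)

theorem healpix_sphericalPoint {φ θ : ℝ} (hφ : φ ∈ Set.Ico 0 (2 * Real.pi))
    (hθ : θ ∈ Set.Ioo 0 Real.pi) :
    healpix (sphericalPoint φ θ) = healpixCoord φ (Real.cos θ) := by
  have hs : 0 < Real.sin θ := Real.sin_pos_of_mem_Ioo hθ
  have h : longitude (sphericalPoint φ θ) = φ := by
    have h1 : (⟨(sphericalPoint φ θ).1 0, (sphericalPoint φ θ).1 1⟩ : ℂ) =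
        (Real.sin θ : ℂ) * (Complex.cos φ + Complex.sin φ * Complex.I) := by
      rw [← Complex.ofReal_cos, ← Complex.ofReal_sin]
      apply Complex.ext <;>
        simp [sphericalPoint, mul_comm, Complex.cos_ofReal_re, Complex.sin_ofReal_re]
    rw [longitude, h1, Complex.arg_mul_cos_add_sin_mul_I_eq_toIocMod hs, toIcoMod_toIocMod,
      toIcoMod_eq_self]
    simpa using hφ
  rw [healpix, h]
  simp [sphericalPoint]

end

open scoped Real

/-! In longitude `ψ` and height `z` the circle is `A√(1 - z²) cos (ψ - φ) + B z = t`, symmetric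
about the meridian `φ` of its center. On either half, `cos (ψ - φ)` as a function of `z` has a
derivative with the sign of `t z - B`, which changes at most once. So the circle, poles aside,
splits into four pieces on which `ψ` is monotone in `z` (`halfCircle_monotone`).

Inside one quarter-turn column the projection moves a point by at most `|Δψ| / π + |Δ
meridianLength|` (`dist_healpixLift_le`). On a monotone piece this sum is the variation of a single
real function. Jumps between columns add no length, since the columns occupy disjoint intervals of
its values (`hausdorffMeasure_image_le_of_fiberwise`).

Each piece has `|Δψ| ≤ π`, and the two pieces of a half share the total range `(√2 + 1) / 2` of
`meridianLength`. A half thus costs at most `2 + (√2 + 1) / 2`, the circle `5 + √2`. -/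

/-! ### Length bounds by comparison with a real parameter. -/

theorem hausdorffMeasure_image_le_volume {α X : Type*} [MetricSpace X] [MeasurableSpace X]
    [BorelSpace X] (f : α → X) (h : α → ℝ) (S : Set α)
    (hd : ∀ a ∈ S, ∀ b ∈ S, dist (f a) (f b) ≤ |h a - h b|) :
    Measure.hausdorffMeasure 1 (f '' S) ≤ volume (h '' S) := by
  rcases S.eq_empty_or_nonempty with rfl | ⟨a₀, ha₀⟩
  · simp
  have : Nonempty α := ⟨a₀⟩
  have hinv : ∀ a ∈ S, Function.invFunOn h S (h a) ∈ S ∧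
      h (Function.invFunOn h S (h a)) = h a := fun a ha =>
    ⟨Function.invFunOn_mem ⟨a, ha, rfl⟩, Function.invFunOn_eq ⟨a, ha, rfl⟩⟩
  -- By `hd`, `f` is constant on the fibres of `h`, so it factors through `h` whichever preimages
  -- are chosen.
  have hL : LipschitzOnWith 1 (fun u => f (Function.invFunOn h S u)) (h '' S) := by
    refine LipschitzOnWith.of_dist_le_mul ?_
    rintro _ ⟨a, ha, rfl⟩ _ ⟨b, hb, rfl⟩
    have := hd _ (hinv a ha).1 _ (hinv b hb).1
    rw [(hinv a ha).2, (hinv b hb).2] at this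
    simpa [Real.dist_eq] using this
  have hS : f '' S = (fun u => f (Function.invFunOn h S u)) '' (h '' S) := by
    rw [Set.image_image]
    refine Set.image_congr fun a ha => ?_
    have := hd a ha _ (hinv a ha).1
    rw [(hinv a ha).2, sub_self, abs_zero] at this
    exact dist_le_zero.1 this
  have := hL.hausdorffMeasure_image_le (zero_le_one (α := ℝ))
  rw [← hS] at this
  simpa [MeasureTheory.hausdorffMeasure_real] using this

/-- If `f` is `1`-Lipschitz as a function of `h` on each fibre of `c`, and `c` is monotone as a
function of `h`, then the image of `f` has length at most the range of `h`. -/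
theorem hausdorffMeasure_image_le_of_fiberwise {α X : Type*} [MetricSpace X] [MeasurableSpace X]
    [BorelSpace X] (f : α → X) (h : α → ℝ) (c : α → ℤ) (S : Set α) (p q : ℝ)
    (hd : ∀ a ∈ S, ∀ b ∈ S, c a = c b → dist (f a) (f b) ≤ |h a - h b|)
    (hc : ∀ a ∈ S, ∀ b ∈ S, h a ≤ h b → c a ≤ c b)
    (hr : ∀ a ∈ S, h a ∈ Set.Icc p q) :
    Measure.hausdorffMeasure 1 (f '' S) ≤ ENNReal.ofReal (q - p) := by
  let T : ℤ → Set α := fun k => {a ∈ S | c a = k}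
  -- The order-convex hull of `h '' T k`: measurable even if `h '' T k` is not, and still disjoint
  -- for distinct `k` because `c` is monotone in `h`.
  let J : ℤ → Set ℝ := fun k => {u | ∃ a ∈ T k, ∃ b ∈ T k, h a ≤ u ∧ u ≤ h b}
  have hJord : ∀ k, (J k).OrdConnected := fun k => ⟨by
    rintro u ⟨a, ha, -, -, hau, -⟩ v ⟨-, -, b, hb, -, hvb⟩ x hx
    exact ⟨a, ha, b, hb, hau.trans hx.1, hx.2.trans hvb⟩⟩
  have hJdisj : Pairwise (Function.onFun Disjoint J) := by
    intro j k hjk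
    rw [Function.onFun, Set.disjoint_left]
    rintro u ⟨a, ha, b, hb, hau, hub⟩ ⟨a', ha', b', hb', hau', hub'⟩
    refine hjk (le_antisymm ?_ ?_)
    · rw [← ha.2, ← hb'.2]; exact hc _ ha.1 _ hb'.1 (hau.trans hub')
    · rw [← ha'.2, ← hb.2]; exact hc _ ha'.1 _ hb.1 (hau'.trans hub)
  have hcover : f '' S = ⋃ k, f '' T k := by
    rw [← Set.image_iUnion]
    congr 1
    ext a
    simp [T]
  calc Measure.hausdorffMeasure 1 (f '' S)
      ≤ ∑' k, Measure.hausdorffMeasure 1 (f '' T k) := by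
        rw [hcover]; exact measure_iUnion_le _
    _ ≤ ∑' k, volume (J k) := by
        refine ENNReal.tsum_le_tsum fun k => ?_
        refine (hausdorffMeasure_image_le_volume f h (T k) fun a ha b hb =>
          hd a ha.1 b hb.1 (ha.2.trans hb.2.symm)).trans (measure_mono ?_)
        rintro _ ⟨a, ha, rfl⟩
        exact ⟨a, ha, a, ha, le_rfl, le_rfl⟩
    _ = volume (⋃ k, J k) :=
        (measure_iUnion hJdisj fun k => (hJord k).measurableSet).symm
    _ ≤ volume (Set.Icc p q) := by
        refine measure_mono (Set.iUnion_subset fun k => ?_)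
        rintro u ⟨a, ha, b, hb, hau, hub⟩
        exact ⟨(hr a ha.1).1.trans hau, hub.trans (hr b hb.1).2⟩
    _ = ENNReal.ofReal (q - p) := Real.volume_Icc

/-! ### The projection in unified coordinates and its local metric estimate. -/

noncomputable section

/-- Ordinate of the equatorial part of the projection, frozen outside the equatorial belt. -/
def beltHeight (z : ℝ) : ℝ := 3 / 8 * max (-(2 / 3)) (min z (2 / 3))

/-- Excess of the ordinate of the projection over its values on the equatorial belt. -/
def polarHeight (z : ℝ) : ℝ :=
  (√(1 - max (-z) (2 / 3)) * √3 - √(1 - max z (2 / 3)) * √3) / 4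

/-- Length of the longest image of an arc of a meridian from the equator to height `z`. -/
def meridianLength (z : ℝ) : ℝ := √2 * polarHeight z + beltHeight z

/-- The HEALPix projection in terms of a longitude that is not reduced modulo `2 * π`. -/
def healpixLift (p : ℝ × ℝ) : EuclideanSpace ℝ (Fin 2) :=
  healpixCoord (toIcoMod Real.two_pi_pos 0 p.1) p.2

end

theorem beltHeight_monotone : Monotone beltHeight := by
  intro a b hab
  unfold beltHeight
  gcongr

theorem polarHeight_monotone : Monotone polarHeight := by
  intro a b hab
  unfold polarHeight
  gcongr

theorem meridianLength_monotone : Monotone meridianLength := by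
  intro a b hab
  unfold meridianLength
  gcongr
  · exact polarHeight_monotone hab
  · exact beltHeight_monotone hab

theorem sqrt_third_mul_sqrt_three : √(1 - 2 / 3) * √3 = 1 := by
  rw [← Real.sqrt_mul (by norm_num)]; norm_num

theorem meridianLength_one : meridianLength 1 = (√2 + 1) / 4 := by
  have := sqrt_third_mul_sqrt_three
  have h1 : max (-1 : ℝ) (2 / 3) = 2 / 3 := by norm_num
  have h2 : max (1 : ℝ) (2 / 3) = 1 := by norm_num
  have h3 : max (-(2 / 3) : ℝ) (min 1 (2 / 3)) = 2 / 3 := by norm_num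
  simp only [meridianLength, polarHeight, beltHeight, h1, h2, h3, this]
  norm_num
  ring

theorem meridianLength_neg_one : meridianLength (-1) = -((√2 + 1) / 4) := by
  have := sqrt_third_mul_sqrt_three
  have h1 : max (-1 : ℝ) (2 / 3) = 2 / 3 := by norm_num
  have h2 : max (1 : ℝ) (2 / 3) = 1 := by norm_num
  have h3 : max (-(2 / 3) : ℝ) (min (-1) (2 / 3)) = -(2 / 3) := by norm_num
  simp only [meridianLength, polarHeight, beltHeight, neg_neg, h1, h2, h3, this]
  norm_num
  ring

/-- The three cases merge because `4 * |polarHeight z|` is `1 - √(3 * (1 - |z|))` on the polar caps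
and `0` on the belt. -/
theorem healpixCoord_eq (φ z : ℝ) :
    healpixCoord φ z = !₂[(φ - 4 * |polarHeight z| *
      (toIcoMod Real.pi_div_two_pos 0 φ - π / 4)) / π, beltHeight z + polarHeight z] := by
  have hs := sqrt_third_mul_sqrt_three
  have hle : ∀ v : ℝ, 2 / 3 ≤ v → √(1 - v) * √3 ≤ 1 := by
    intro v hv
    refine le_of_le_of_eq ?_ hs
    gcongr
  have hπ : π ≠ 0 := Real.pi_ne_zero
  unfold healpixCoord
  split_ifs with h1 h2
  · rw [abs_le] at h1
    have e0 : polarHeight z = 0 := by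
      rw [polarHeight, max_eq_right (by linarith), max_eq_right (by linarith)]; simp
    have c0 : beltHeight z = 3 / 8 * z := by
      rw [beltHeight, min_eq_left (by linarith), max_eq_right (by linarith)]
    simp [e0, c0]
  · have e0 : polarHeight z = (1 - √(1 - z) * √3) / 4 := by
      rw [polarHeight, max_eq_right (by linarith), max_eq_left (by linarith), hs]
    have c0 : beltHeight z = 1 / 4 := by
      rw [beltHeight, min_eq_right (by linarith), max_eq_right (by linarith)]; norm_num
    rw [e0, c0, abs_of_nonneg (by linarith [hle z h2.le])]
    ext i; fin_cases i <;> simp <;> field_simp; ring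
  · have h3 : z < -(2 / 3) := by
      by_contra h
      exact h1 (abs_le.2 ⟨by linarith, by linarith⟩)
    have hz' : |z| = -z := abs_of_neg (by linarith)
    have e0 : polarHeight z = -((1 - √(1 - |z|) * √3) / 4) := by
      rw [polarHeight, max_eq_left (by linarith), max_eq_right (by linarith), hs, hz']
      ring
    have c0 : beltHeight z = -(1 / 4) := by
      rw [beltHeight, min_eq_left (by linarith), max_eq_left (by linarith)]; norm_num
    have hle' : 0 ≤ (1 - √(1 - |z|) * √3) / 4 := by linarith [hle |z| (by linarith)]
    rw [e0, c0, abs_neg, abs_of_nonneg hle']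
    ext i; fin_cases i <;> simp <;> field_simp; ring

theorem abs_polarHeight_le (z : ℝ) : 4 * |polarHeight z| ≤ 1 := by
  have hs := sqrt_third_mul_sqrt_three
  have hle : ∀ v : ℝ, √(1 - max v (2 / 3)) * √3 ≤ 1 := by
    intro v
    refine le_of_le_of_eq ?_ hs
    gcongr
    exact le_max_right _ _
  have h0 : ∀ v : ℝ, 0 ≤ √(1 - max v (2 / 3)) * √3 := fun v => by positivity
  have : |polarHeight z| ≤ 1 / 4 := by
    rw [polarHeight, abs_le]
    constructor <;> linarith [hle z, hle (-z), h0 z, h0 (-z)]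
  linarith

/-- Here `k` numbers the quarter turns, so the integer quotient `k / 4` counts the full turns to
remove. -/
theorem healpixLift_eq {ψ : ℝ} {k : ℤ} (hk : ⌊ψ / (π / 2)⌋ = k) (z : ℝ) :
    healpixLift (ψ, z) = !₂[(ψ - ((k / 4 : ℤ) : ℝ) * (2 * π) - 4 * |polarHeight z| *
      (ψ - k * (π / 2) - π / 4)) / π, beltHeight z + polarHeight z] ∧
      ψ - k * (π / 2) ∈ Set.Icc 0 (π / 2) := by
  have hπ := Real.pi_pos
  rw [Int.floor_eq_iff, le_div_iff₀ (by positivity), div_lt_iff₀ (by positivity)] at hk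
  have h1 : toIcoMod Real.two_pi_pos 0 ψ = ψ - ((k / 4 : ℤ) : ℝ) * (2 * π) := by
    rw [toIcoMod_eq_iff]
    have l1 : ((4 * (k / 4) : ℤ) : ℝ) ≤ k := by exact_mod_cast (by lia : 4 * (k / 4) ≤ k)
    have l2 : (k : ℝ) + 1 ≤ ((4 * (k / 4) + 4 : ℤ) : ℝ) := by
      exact_mod_cast (by lia : k + 1 ≤ 4 * (k / 4) + 4)
    push_cast at l1 l2
    refine ⟨⟨by nlinarith, by nlinarith⟩, k / 4, ?_⟩
    simp
  have h2 : toIcoMod Real.pi_div_two_pos 0 (ψ - ((k / 4 : ℤ) : ℝ) * (2 * π)) =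
      ψ - k * (π / 2) := by
    rw [toIcoMod_eq_iff]
    refine ⟨⟨by linarith, by linarith⟩, k - 4 * (k / 4), ?_⟩
    rw [zsmul_eq_mul]; push_cast; ring
  refine ⟨?_, by linarith, by linarith⟩
  rw [healpixLift, healpixCoord_eq, h1, h2]

/-- With `D`, `E`, `C` the changes of `ψ / π`, `polarHeight` and `beltHeight`, the coordinates move
by at most `D + E` and `E + C`, and `(D + E)² + (E + C)² ≤ (D + √2 E + C)²`. -/
theorem dist_healpixLift_le {p q : ℝ × ℝ} (h : ⌊p.1 / (π / 2)⌋ = ⌊q.1 / (π / 2)⌋) :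
    dist (healpixLift p) (healpixLift q) ≤
      |p.1 - q.1| / π + |meridianLength p.2 - meridianLength q.2| := by
  obtain ⟨a, y⟩ := p
  obtain ⟨b, z⟩ := q
  have hπ := Real.pi_pos
  obtain ⟨ha, ha'⟩ := healpixLift_eq h y
  obtain ⟨hb, hb'⟩ := healpixLift_eq (rfl : ⌊b / (π / 2)⌋ = _) z
  simp only at h ha hb ⊢
  set k := ⌊b / (π / 2)⌋
  have hmer : |meridianLength y - meridianLength z| =
      √2 * |polarHeight y - polarHeight z| + |beltHeight y - beltHeight z| := by
    rcases le_total y z with hyz | hyz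
    · rw [abs_of_nonpos (sub_nonpos.2 (meridianLength_monotone hyz)),
        abs_of_nonpos (sub_nonpos.2 (polarHeight_monotone hyz)),
        abs_of_nonpos (sub_nonpos.2 (beltHeight_monotone hyz))]
      simp only [meridianLength]; ring
    · rw [abs_of_nonneg (sub_nonneg.2 (meridianLength_monotone hyz)),
        abs_of_nonneg (sub_nonneg.2 (polarHeight_monotone hyz)),
        abs_of_nonneg (sub_nonneg.2 (beltHeight_monotone hyz))]
      simp only [meridianLength]; ring
  rw [ha, hb, hmer, EuclideanSpace.dist_eq]
  simp only [Fin.sum_univ_two, Real.dist_eq]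
  set D := |a - b| / π with hD
  set E := |polarHeight y - polarHeight z| with hE
  set C := |beltHeight y - beltHeight z| with hC
  have hD0 : 0 ≤ D := by positivity
  have hE0 : 0 ≤ E := abs_nonneg _
  have hC0 : 0 ≤ C := abs_nonneg _
  have hy : |(beltHeight y + polarHeight y) - (beltHeight z + polarHeight z)| ≤ E + C := by
    rw [show (beltHeight y + polarHeight y) - (beltHeight z + polarHeight z) =
      (polarHeight y - polarHeight z) + (beltHeight y - beltHeight z) by ring]
    exact abs_add_le _ _
  have hx : |(a - ((k / 4 : ℤ) : ℝ) * (2 * π) - 4 * |polarHeight y| *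
      (a - k * (π / 2) - π / 4)) / π - (b - ((k / 4 : ℤ) : ℝ) * (2 * π) - 4 * |polarHeight z| *
      (b - k * (π / 2) - π / 4)) / π| ≤ D + E := by
    rw [show (a - ((k / 4 : ℤ) : ℝ) * (2 * π) - 4 * |polarHeight y| *
      (a - k * (π / 2) - π / 4)) / π - (b - ((k / 4 : ℤ) : ℝ) * (2 * π) - 4 * |polarHeight z| *
      (b - k * (π / 2) - π / 4)) / π =
      (1 - 4 * |polarHeight y|) * (a - b) / π + (|polarHeight z| - |polarHeight y|) *
        (4 * (b - k * (π / 2) - π / 4) / π) by ring]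
    refine (abs_add_le _ _).trans (add_le_add ?_ ?_)
    · rw [abs_div, abs_mul, abs_of_pos hπ, hD]
      have h1 := abs_polarHeight_le y
      have h2 : abs (1 - 4 * |polarHeight y|) ≤ 1 := by
        rw [abs_le]; constructor <;> linarith [abs_nonneg (polarHeight y)]
      gcongr
      exact mul_le_of_le_one_left (abs_nonneg _) h2
    · rw [abs_mul, hE, abs_sub_comm (polarHeight y)]
      have h2 : |4 * (b - k * (π / 2) - π / 4) / π| ≤ 1 := by
        rw [abs_div, abs_of_pos hπ, div_le_one hπ, abs_le]
        constructor <;> linarith [hb'.1, hb'.2]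
      exact (mul_le_of_le_one_right (abs_nonneg _) h2).trans (abs_abs_sub_abs_le _ _)
  apply Real.sqrt_le_iff.2
  have h2 : (1 : ℝ) ≤ √2 := Real.one_le_sqrt.2 (by norm_num)
  have h2' : √2 * √2 = 2 := Real.mul_self_sqrt (by norm_num)
  refine ⟨by positivity, ?_⟩
  simp only [Matrix.cons_val_zero, Matrix.cons_val_one]
  have hx2 := pow_le_pow_left₀ (abs_nonneg _) hx 2
  have hy2 := pow_le_pow_left₀ (abs_nonneg _) hy 2
  refine (add_le_add hx2 hy2).trans ?_
  have e1 := mul_nonneg (sub_nonneg.2 h2) (mul_nonneg hD0 hE0)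
  have e2 := mul_nonneg (sub_nonneg.2 h2) (mul_nonneg hC0 hE0)
  have e3 := mul_nonneg hD0 hC0
  have e4 : (D + (√2 * E + C)) ^ 2 = (D + E) ^ 2 + (E + C) ^ 2 + (√2 * √2 - 2) * E ^ 2 +
      2 * ((√2 - 1) * (D * E)) + 2 * ((√2 - 1) * (C * E)) + 2 * (D * C) := by ring
  rw [e4, h2', sub_self, zero_mul]
  linarith

/-- A part of a graph on which latitude and longitude vary monotonically has an image of length at
most the total variation of longitude and `meridianLength`. -/
theorem hausdorffMeasure_healpixLift_image_le (S : Set (ℝ × ℝ)) (σ a b y z : ℝ)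
    (hσ : σ = 1 ∨ σ = -1)
    (hmono : ∀ p ∈ S, ∀ q ∈ S, p.2 < q.2 → σ * p.1 ≤ σ * q.1)
    (hψ : ∀ p ∈ S, p.1 ∈ Set.Icc a b) (hz : ∀ p ∈ S, p.2 ∈ Set.Icc y z) :
    Measure.hausdorffMeasure 1 (healpixLift '' S) ≤
      ENNReal.ofReal ((b - a) / π + (meridianLength z - meridianLength y)) := by
  have hπ := Real.pi_pos
  -- Contrapositive of `hmono`, whose strict inequality leaves points of equal height unconstrained;
  -- this admits parallels.
  have key : ∀ p ∈ S, ∀ q ∈ S, p.1 < q.1 →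
      σ * meridianLength p.2 ≤ σ * meridianLength q.2 := by
    intro p hp q hq hpq
    rcases hσ with rfl | rfl
    · have : p.2 ≤ q.2 := by
        by_contra! h
        linarith [hmono q hq p hp h]
      linarith [meridianLength_monotone this]
    · have : q.2 ≤ p.2 := by
        by_contra! h
        linarith [hmono p hp q hq h]
      linarith [meridianLength_monotone this]
  -- Both increments have the same sign once the second is multiplied by `σ`, so their absolute
  -- values add.
  have hdist : ∀ p ∈ S, ∀ q ∈ S,
      |p.1 - q.1| / π + |meridianLength p.2 - meridianLength q.2| =
        |(p.1 / π + σ * meridianLength p.2) - (q.1 / π + σ * meridianLength q.2)| := by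
    intro p hp q hq
    have e : (p.1 / π + σ * meridianLength p.2) - (q.1 / π + σ * meridianLength q.2) =
        (p.1 - q.1) / π + (σ * meridianLength p.2 - σ * meridianLength q.2) := by ring
    have e' : |meridianLength p.2 - meridianLength q.2| =
        |σ * meridianLength p.2 - σ * meridianLength q.2| := by
      rw [← mul_sub, abs_mul]
      rcases hσ with rfl | rfl <;> simp
    have e'' : |p.1 - q.1| / π = |(p.1 - q.1) / π| := by rw [abs_div, abs_of_pos hπ]
    rw [e, e', e'', eq_comm, abs_add_eq_add_abs_iff]
    rcases lt_trichotomy p.1 q.1 with h | h | h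
    · right
      exact ⟨div_nonpos_of_nonpos_of_nonneg (by linarith) hπ.le,
        by linarith [key p hp q hq h]⟩
    · rw [h, sub_self, zero_div]
      rcases le_total 0 (σ * meridianLength p.2 - σ * meridianLength q.2) with h' | h'
      · exact Or.inl ⟨le_rfl, h'⟩
      · exact Or.inr ⟨le_rfl, h'⟩
    · left
      exact ⟨div_nonneg (by linarith) hπ.le, by linarith [key q hq p hp h]⟩
  have hmer : ∀ p ∈ S, meridianLength p.2 ∈ Set.Icc (meridianLength y) (meridianLength z) :=
    fun p hp => ⟨meridianLength_monotone (hz p hp).1, meridianLength_monotone (hz p hp).2⟩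
  have hdiv : ∀ p ∈ S, p.1 / π ∈ Set.Icc (a / π) (b / π) := fun p hp =>
    ⟨div_le_div_of_nonneg_right (hψ p hp).1 hπ.le, div_le_div_of_nonneg_right (hψ p hp).2 hπ.le⟩
  have hfib : ∀ (u v : ℝ), (∀ p ∈ S, p.1 / π + σ * meridianLength p.2 ∈ Set.Icc u v) →
      Measure.hausdorffMeasure 1 (healpixLift '' S) ≤ ENNReal.ofReal (v - u) := by
    intro u v huv
    refine hausdorffMeasure_image_le_of_fiberwise healpixLift
      (fun p => p.1 / π + σ * meridianLength p.2) (fun p => ⌊p.1 / (π / 2)⌋) S u v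
      (fun p hp q hq h => (dist_healpixLift_le h).trans (hdist p hp q hq).le) ?_ huv
    intro p hp q hq h
    have : p.1 ≤ q.1 := by
      by_contra! h'
      have h1 := key q hq p hp h'
      have h2 : q.1 / π < p.1 / π := div_lt_div_of_pos_right h' hπ
      linarith
    exact Int.floor_le_floor (by gcongr)
  rcases hσ with rfl | rfl
  · refine (hfib (a / π + meridianLength y) (b / π + meridianLength z) fun p hp => ?_).trans_eq ?_
    · have h1 := hmer p hp
      have h2 := hdiv p hp
      exact ⟨by linarith [h1.1, h2.1], by linarith [h1.2, h2.2]⟩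
    · congr 1; ring
  · refine (hfib (a / π - meridianLength z) (b / π - meridianLength y) fun p hp => ?_).trans_eq ?_
    · have h1 := hmer p hp
      have h2 := hdiv p hp
      exact ⟨by linarith [h1.2, h2.1], by linarith [h1.1, h2.2]⟩
    · congr 1; ring

/-! ### Monotonicity of longitude along half a circle. -/

theorem hasDerivAt_sub_mul_div_sqrt (B t : ℝ) {z : ℝ} (hz : z ∈ Set.Ioo (-1 : ℝ) 1) :
    HasDerivAt (fun z => (t - B * z) / √(1 - z ^ 2))
      ((t * z - B) / (√(1 - z ^ 2) * (1 - z ^ 2))) z := by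
  have h0 : 0 < 1 - z ^ 2 := by nlinarith [hz.1, hz.2]
  have h1 : HasDerivAt (fun z => t - B * z) (-B) z := by
    simpa using ((hasDerivAt_id z).const_mul B).const_sub t
  have h2 : HasDerivAt (fun z : ℝ => 1 - z ^ 2) (-(2 * z)) z := by
    simpa using ((hasDerivAt_id z).pow 2).const_sub 1
  have h3 := h1.div (h2.sqrt h0.ne') (Real.sqrt_pos.2 h0).ne'
  refine h3.congr_deriv ?_
  have hs : √(1 - z ^ 2) ^ 2 = 1 - z ^ 2 := Real.sq_sqrt h0.le
  have hs0 := (Real.sqrt_pos.2 h0).ne'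
  rw [hs]
  field_simp
  rw [hs]
  ring

/-- On an interval where `σ * (t * z - B)` has constant sign, so has the variation of
`(t - B * z) / √(1 - z ^ 2)`. -/
theorem mul_sub_mul_div_sqrt_le {B t σ y z : ℝ} (hy : y ∈ Set.Ioo (-1 : ℝ) 1)
    (hz : z ∈ Set.Ioo (-1 : ℝ) 1) (hyz : y ≤ z)
    (h : ∀ x ∈ Set.Icc y z, 0 ≤ σ * (t * x - B)) :
    σ * ((t - B * y) / √(1 - y ^ 2)) ≤ σ * ((t - B * z) / √(1 - z ^ 2)) := by
  have hI : ∀ x ∈ Set.Icc y z, x ∈ Set.Ioo (-1 : ℝ) 1 := fun x hx =>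
    ⟨hy.1.trans_le hx.1, hx.2.trans_lt hz.2⟩
  have hd : ∀ x ∈ Set.Icc y z, HasDerivAt (fun x => σ * ((t - B * x) / √(1 - x ^ 2)))
      (σ * ((t * x - B) / (√(1 - x ^ 2) * (1 - x ^ 2)))) x := fun x hx =>
    (hasDerivAt_sub_mul_div_sqrt B t (hI x hx)).const_mul σ
  refine monotoneOn_of_deriv_nonneg (convex_Icc y z)
    (fun x hx => (hd x hx).continuousAt.continuousWithinAt)
    (fun x hx => (hd x (interior_subset hx)).differentiableAt.differentiableWithinAt)
    (fun x hx => ?_) (Set.left_mem_Icc.2 hyz) (Set.right_mem_Icc.2 hyz) hyz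
  have hx' := interior_subset hx
  rw [(hd x hx').deriv, ← mul_div_assoc]
  have h0 : 0 ≤ 1 - x ^ 2 := by nlinarith [(hI x hx').1, (hI x hx').2]
  exact div_nonneg (h x hx') (mul_nonneg (Real.sqrt_nonneg _) h0)

/-- The root `B / t` of an affine function, clamped to `[-1, 1]`. For `t = 0` the sign is constant
and `c = 1` empties the second interval. -/
theorem exists_sign_change (B t : ℝ) : ∃ c ∈ Set.Icc (-1 : ℝ) 1, ∃ σ : ℝ, (σ = 1 ∨ σ = -1) ∧
    (∀ x ∈ Set.Ioc (-1) c, 0 ≤ σ * (t * x - B)) ∧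
      ∀ x ∈ Set.Ico c 1, 0 ≤ (-σ) * (t * x - B) := by
  rcases lt_trichotomy t 0 with ht | rfl | ht
  · refine ⟨max (-1) (min 1 (B / t)), ⟨le_max_left _ _, max_le (by norm_num) (min_le_left _ _)⟩, 1,
      Or.inl rfl, fun x hx => ?_, fun x hx => ?_⟩
    · have h := (le_max_iff.1 hx.2).resolve_left (not_le.2 hx.1)
      have := (le_div_iff_of_neg ht).1 (le_min_iff.1 h).2
      linarith
    · have h := (min_le_iff.1 (max_le_iff.1 hx.1).2).resolve_left (not_le.2 hx.2)
      have := (div_le_iff_of_neg ht).1 h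
      linarith
  · rcases le_total 0 B with hB | hB
    · exact ⟨1, by norm_num, -1, Or.inr rfl, fun x _ => by linarith,
        fun x hx => absurd hx.1 (not_le.2 hx.2)⟩
    · exact ⟨1, by norm_num, 1, Or.inl rfl, fun x _ => by linarith,
        fun x hx => absurd hx.1 (not_le.2 hx.2)⟩
  · refine ⟨max (-1) (min 1 (B / t)), ⟨le_max_left _ _, max_le (by norm_num) (min_le_left _ _)⟩, -1,
      Or.inr rfl, fun x hx => ?_, fun x hx => ?_⟩
    · have h := (le_max_iff.1 hx.2).resolve_left (not_le.2 hx.1)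
      have := (le_div_iff₀ ht).1 (le_min_iff.1 h).2
      linarith
    · have h := (min_le_iff.1 (max_le_iff.1 hx.1).2).resolve_left (not_le.2 hx.2)
      have := (div_le_iff₀ ht).1 h
      linarith

/-- The points of a circle on the sphere other than the poles, as pairs of a lifted longitude,
within half a turn `[φ, φ + τ * π]` of the meridian `φ` of the center, and a height. -/
def halfCircle (φ A B t τ : ℝ) : Set (ℝ × ℝ) :=
  {p | p.2 ∈ Set.Ioo (-1 : ℝ) 1 ∧ τ * (p.1 - φ) ∈ Set.Icc 0 π ∧
    A * √(1 - p.2 ^ 2) * Real.cos (p.1 - φ) + B * p.2 = t}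

/-- The factor `τ` brings the relative longitude into `[0, π]`, where cosine decreases; hence the
sign `-(σ * τ)`. -/
theorem halfCircle_monotone {φ A B t τ σ : ℝ} (hA : 0 ≤ A) (hAB : A ^ 2 + B ^ 2 = 1)
    (hτ : τ = 1 ∨ τ = -1) (hσ : σ = 1 ∨ σ = -1) {p q : ℝ × ℝ} (hp : p ∈ halfCircle φ A B t τ)
    (hq : q ∈ halfCircle φ A B t τ) (hpq : p.2 < q.2)
    (h : ∀ x ∈ Set.Icc p.2 q.2, 0 ≤ σ * (t * x - B)) :
    -(σ * τ) * p.1 ≤ -(σ * τ) * q.1 := by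
  obtain ⟨hp1, hp2, hp3⟩ := hp
  obtain ⟨hq1, hq2, hq3⟩ := hq
  have hcos : ∀ x : ℝ, Real.cos (τ * x) = Real.cos x := by
    intro x; rcases hτ with rfl | rfl <;> simp
  -- If `A = 0` the circle is a parallel and has no two points of different heights.
  have hA' : 0 < A := by
    refine hA.lt_of_ne fun h0 => ?_
    subst h0
    have hB : B ≠ 0 := by rintro rfl; norm_num at hAB
    simp only [zero_mul, zero_add] at hp3 hq3
    exact hpq.ne (mul_left_cancel₀ hB (hp3.trans hq3.symm))
  have hF : ∀ r : ℝ × ℝ, r.2 ∈ Set.Ioo (-1 : ℝ) 1 →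
      A * √(1 - r.2 ^ 2) * Real.cos (r.1 - φ) + B * r.2 = t →
      (t - B * r.2) / √(1 - r.2 ^ 2) = A * Real.cos (τ * (r.1 - φ)) := by
    intro r hr hr3
    have : 0 < √(1 - r.2 ^ 2) := Real.sqrt_pos.2 (by nlinarith [hr.1, hr.2])
    rw [hcos, div_eq_iff this.ne', ← hr3]
    ring
  have hm := mul_sub_mul_div_sqrt_le hp1 hq1 hpq.le h
  rw [hF p hp1 hp3, hF q hq1 hq3] at hm
  have hm' : σ * Real.cos (τ * (p.1 - φ)) ≤ σ * Real.cos (τ * (q.1 - φ)) := by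
    refine le_of_mul_le_mul_left ?_ hA'
    linarith
  rcases hσ with rfl | rfl
  · have := (Real.strictAntiOn_cos.le_iff_ge hp2 hq2).1 (by linarith)
    linarith
  · have := (Real.strictAntiOn_cos.le_iff_ge hq2 hp2).1 (by linarith)
    linarith

theorem hausdorffMeasure_healpixLift_halfCircle_le {φ A B t τ : ℝ} (hA : 0 ≤ A)
    (hAB : A ^ 2 + B ^ 2 = 1) (hτ : τ = 1 ∨ τ = -1) :
    Measure.hausdorffMeasure 1 (healpixLift '' halfCircle φ A B t τ) ≤
      ENNReal.ofReal ((5 + √2) / 2) := by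
  have hπ := Real.pi_pos
  obtain ⟨c, hc, σ, hσ, h1, h2⟩ := exists_sign_change B t
  have hστ : -(σ * τ) = 1 ∨ -(σ * τ) = -1 := by
    rcases hσ with rfl | rfl <;> rcases hτ with rfl | rfl <;> norm_num
  obtain ⟨a, hab⟩ : ∃ a, ∀ p ∈ halfCircle φ A B t τ, p.1 ∈ Set.Icc a (a + π) := by
    rcases hτ with rfl | rfl
    · exact ⟨φ, fun p hp => ⟨by linarith [hp.2.1.1], by linarith [hp.2.1.2]⟩⟩
    · exact ⟨φ - π, fun p hp => ⟨by linarith [hp.2.1.2], by linarith [hp.2.1.1]⟩⟩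
  have hlow := hausdorffMeasure_healpixLift_image_le {p ∈ halfCircle φ A B t τ | p.2 ≤ c}
    (-(σ * τ)) a (a + π) (-1) c hστ
    (fun p hp q hq hpq => halfCircle_monotone hA hAB hτ hσ hp.1 hq.1 hpq fun x hx =>
      h1 x ⟨hp.1.1.1.trans_le hx.1, hx.2.trans hq.2⟩)
    (fun p hp => hab p hp.1) (fun p hp => ⟨hp.1.1.1.le, hp.2⟩)
  have hhigh := hausdorffMeasure_healpixLift_image_le {p ∈ halfCircle φ A B t τ | c ≤ p.2}
    (-(-σ * τ)) a (a + π) c 1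
    (by rw [neg_mul, neg_neg]; rw [neg_inj, neg_eq_iff_eq_neg] at hστ; exact hστ.symm)
    (fun p hp q hq hpq => halfCircle_monotone hA hAB hτ
      (by rw [neg_inj, neg_eq_iff_eq_neg]; exact hσ.symm) hp.1 hq.1 hpq fun x hx =>
      h2 x ⟨hp.2.trans hx.1, hx.2.trans_lt hq.1.1.2⟩)
    (fun p hp => hab p hp.1) (fun p hp => ⟨hp.2, hp.1.1.2.le⟩)
  have hsub : healpixLift '' halfCircle φ A B t τ ⊆
      healpixLift '' {p ∈ halfCircle φ A B t τ | p.2 ≤ c} ∪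
        healpixLift '' {p ∈ halfCircle φ A B t τ | c ≤ p.2} := by
    rw [← Set.image_union]
    refine Set.image_mono fun p hp => ?_
    exact (le_total p.2 c).imp (fun h => ⟨hp, h⟩) fun h => ⟨hp, h⟩
  refine (measure_mono hsub).trans ((measure_union_le _ _).trans
    ((add_le_add hlow hhigh).trans_eq ?_))
  rw [add_sub_cancel_left, div_self hπ.ne', ← ENNReal.ofReal_add, meridianLength_one,
    meridianLength_neg_one]
  · congr 1; ring
  · linarith [meridianLength_monotone hc.1]
  · linarith [meridianLength_monotone hc.2]

/-! ### Covering the circle by two half circles and the poles. -/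

/-- The complex number formed by the first two coordinates of a point of the sphere. -/
def equatorialPart (x : Sphere2) : ℂ := ⟨x.1 0, x.1 1⟩

theorem norm_equatorialPart_sq (x : Sphere2) : ‖equatorialPart x‖ ^ 2 = 1 - x.1 2 ^ 2 := by
  have h := mem_sphere_zero_iff_norm.1 x.2
  rw [EuclideanSpace.norm_eq, Real.sqrt_eq_one, Fin.sum_univ_three] at h
  simp only [Real.norm_eq_abs, sq_abs] at h
  rw [Complex.sq_norm, Complex.normSq_apply, equatorialPart]
  linarith

theorem inner_eq_cos_arg (x w : Sphere2) :
    inner ℝ (x : EuclideanSpace ℝ (Fin 3)) (w : EuclideanSpace ℝ (Fin 3)) =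
      ‖equatorialPart w‖ * ‖equatorialPart x‖ *
        Real.cos ((equatorialPart x).arg - (equatorialPart w).arg) + w.1 2 * x.1 2 := by
  rw [Real.cos_sub]
  have h1 := Complex.norm_mul_cos_arg (equatorialPart x)
  have h2 := Complex.norm_mul_cos_arg (equatorialPart w)
  have h3 := Complex.norm_mul_sin_arg (equatorialPart x)
  have h4 := Complex.norm_mul_sin_arg (equatorialPart w)
  rw [show ∀ a b c d e f : ℝ, a * b * (c * d + e * f) =
    (b * c) * (a * d) + (b * e) * (a * f) by intros; ring, h1, h2, h3, h4]
  simp [equatorialPart, PiLp.inner_apply, Fin.sum_univ_three]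
  ring

theorem healpix_image_level_subset (w : Sphere2) (t : ℝ) :
    healpix '' {x | inner ℝ (x : EuclideanSpace ℝ (Fin 3)) (w : EuclideanSpace ℝ (Fin 3)) = t} ⊆
      (healpixLift '' halfCircle (equatorialPart w).arg ‖equatorialPart w‖ (w.1 2) t 1 ∪
        healpixLift '' halfCircle (equatorialPart w).arg ‖equatorialPart w‖ (w.1 2) t (-1)) ∪
      {healpixCoord 0 1, healpixCoord 0 (-1)} := by
  rintro _ ⟨x, hx, rfl⟩
  have hn := norm_equatorialPart_sq x
  have hlong : longitude x = toIcoMod Real.two_pi_pos 0 (equatorialPart x).arg := rfl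
  by_cases h0 : equatorialPart x = 0
  · right
    rw [h0, norm_zero] at hn
    have h1 : x.1 2 ^ 2 = 1 := by linarith
    have hl : longitude x = 0 := by
      rw [hlong, h0, Complex.arg_zero, toIcoMod_apply_left]
    rcases mul_self_eq_one_iff.1 ((sq _).symm.trans h1) with h | h
    · left; rw [healpix, hl, h]
    · right; rw [Set.mem_singleton_iff, healpix, hl, h]
  left
  have hpos : 0 < ‖equatorialPart x‖ ^ 2 := by positivity
  have hz : x.1 2 ∈ Set.Ioo (-1 : ℝ) 1 := by
    rw [Set.mem_Ioo, ← abs_lt, ← sq_lt_one_iff_abs_lt_one]; linarith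
  have hr : √(1 - x.1 2 ^ 2) = ‖equatorialPart x‖ := by
    rw [← hn, Real.sqrt_sq (norm_nonneg _)]
  set α := (equatorialPart x).arg with hα
  set φ := (equatorialPart w).arg with hφ
  -- The longitude relative to the center is reduced to `[-π, π)`; its sign selects the half circle.
  have hδ := toIcoMod_mem_Ico Real.two_pi_pos (-π) (α - φ)
  set δ := toIcoMod Real.two_pi_pos (-π) (α - φ) with hδ_def
  set n := toIcoDiv Real.two_pi_pos (-π) (α - φ) with hn_def
  have hδα : φ + δ = α - n • (2 * π) := by
    rw [hδ_def, toIcoMod, ← hn_def]; ring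
  have hcos : Real.cos δ = Real.cos (α - φ) := by
    rw [show δ = (α - φ) - n * (2 * π) by rw [zsmul_eq_mul] at hδα; linarith,
      Real.cos_sub_int_mul_two_pi]
  have himg : healpixLift (φ + δ, x.1 2) = healpix x := by
    rw [healpixLift, healpix, hlong]
    simp only [hδα, toIcoMod_sub_zsmul]
  have hcirc : ‖equatorialPart w‖ * √(1 - x.1 2 ^ 2) * Real.cos (φ + δ - φ) + w.1 2 * x.1 2 = t := by
    rw [add_sub_cancel_left, hcos, hr, ← inner_eq_cos_arg]
    exact hx
  rcases le_total 0 δ with h | h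
  · refine Or.inl ⟨(φ + δ, x.1 2), ⟨hz, ?_, hcirc⟩, himg⟩
    constructor <;> simp only <;> linarith [hδ.2]
  · refine Or.inr ⟨(φ + δ, x.1 2), ⟨hz, ?_, hcirc⟩, himg⟩
    constructor <;> simp only <;> linarith [hδ.1]

theorem frontier_sphericalCap_subset (w : Sphere2) (t : ℝ) :
    frontier (sphericalCap w t) ⊆
      {x | inner ℝ (x : EuclideanSpace ℝ (Fin 3)) (w : EuclideanSpace ℝ (Fin 3)) = t} := by
  intro x hx
  exact (frontier_le_subset_eq continuous_const
    (continuous_subtype_val.inner continuous_const) hx).symm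

theorem proposition2 (w : Sphere2) (t : ℝ) (ht : t ∈ Set.Ioo (-1 : ℝ) 1) :
    Measure.hausdorffMeasure 1 (healpix '' frontier (sphericalCap w t)) ≤
        ENNReal.ofReal (5 + √2) ∧
      5 + √2 < 6.42 := by
  constructor
  · have hAB : ‖equatorialPart w‖ ^ 2 + w.1 2 ^ 2 = 1 := by
      rw [norm_equatorialPart_sq]; ring
    -- The poles contribute at most two image points, hence no length.
    have hpoles : Measure.hausdorffMeasure 1
        ({healpixCoord 0 1, healpixCoord 0 (-1)} : Set (EuclideanSpace ℝ (Fin 2))) = 0 := by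
      have := Measure.nullSingletonClass_hausdorff (EuclideanSpace ℝ (Fin 2)) (zero_lt_one (α := ℝ))
      exact (Set.toFinite _).measure_zero _
    refine (measure_mono ((Set.image_mono (frontier_sphericalCap_subset w t)).trans
      (healpix_image_level_subset w t))).trans ?_
    refine (measure_union_le _ _).trans ?_
    rw [hpoles, add_zero]
    refine (measure_union_le _ _).trans ((add_le_add
      (hausdorffMeasure_healpixLift_halfCircle_le (norm_nonneg _) hAB (Or.inl rfl))
      (hausdorffMeasure_healpixLift_halfCircle_le (norm_nonneg _) hAB (Or.inr rfl))).trans_eq ?_)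
    rw [← ENNReal.ofReal_add (by positivity) (by positivity), add_halves]
  · have : √2 < 1.42 := (Real.sqrt_lt' (by norm_num)).2 (by norm_num)
    norm_num at this ⊢
    linarith
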